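/- **Conventions.** A ranked alphabet is a nonempty finite set of symbols, each with a rank in $\mathbb N$. For a set $S$, $T_\Sigma(S)$ is the set of trees over the ranked alphabet $\Sigma$ with extra leaf labels from $S$, and $T_\Sigma = T_\Sigma(\emptyset)$; $\mathrm{var}(t)\subseteq S$ is the set of leaf labels from $S$ occurring in $t$. A *class of tree transformations* $\mathcal C$ is a collection of relations $R \subseteq T_\Sigma\times T_\Delta$, for ranked alphabets $\Sigma,\Delta$. We put $R_1;R_2=\{(s,u)\mid \exists t\colon (s,t)\in R_1,\ (t,u)\in R_2\}$, $\;\mathcal C_1;\mathcal C_2=\{R_1;R_2\mid R_1\in\mathcal C_1,R_2\in\mathcal C_2\}$ (where $R_1\subseteq T_\Sigma\times T_\Gamma$ and $R_2\subseteq T_\Gamma\times T_\Delta$), $\;\mathcal C^1=\mathcal C$ and $\mathcal C^{n+1}=\mathcal C^n;\mathcal C$. **Bimorphisms.** A tree homomorphism $h$ from $\Gamma$ to $\Sigma$ maps every symbol $\gamma\in\Gamma$ of rank $k$ to a tree $h_k(\gamma)\in T_\Sigma(\{x_1,\dots,x_k\})$ and extends to $T_\Gamma\to T_\Sigma$ by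 substitution. It is *linear* (resp. *complete*) if in $h_k(\gamma)$ each of $x_1,\dots,x_k$ occurs at most once (resp. at least once), for all $\gamma$. $\mathrm B(\mathrm l,\mathrm c)$ is the class of all relations $\{(\psi(t),\varphi(t))\mid t\in L\}$, where $L\subseteq T_\Gamma$ is a regular tree language, $\psi\colon T_\Gamma\to T_\Sigma$ is a linear and $\varphi\colon T_\Gamma\to T_\Delta$ a complete tree homomorphism. **Transducers.** A *linear extended top-down tree transducer with regular look-ahead* (l-xt$^{\mathrm R}$) is a tuple $M=(Q,\Sigma,\Delta,I,R,c)$ with a finite set $Q$ of states, ranked alphabets $\Sigma,\Delta$, initial states $I\subseteq Q$, a finite set $R\subseteq T_\Sigma(Q)\times Q\times T_\Delta(Q)$ of rules such that for each rule $(\ell,q,r)$ every state occurs at most once in $\ell$ and at most once in $r$ and $\mathrm{var}(r)\subseteq\mathrm{var}(\ell)$, and a map $c$ that assigns to each state a regular tree language $c(q)\subseteq T_\Sigma$. A sentential form $\langle\xi,D,\zeta\rangle$ consists of trees $\xi\in T_\Sigma(Q)$, $\zeta\in T_\Delta(Q)$ and a set $D$ of links $(v,w)$ between positions of $\xi$ and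 positions of $\zeta$. A derivation step either applies a rule $(\ell,q,r)$ at a link $(v,w)\in D$ with $\xi(v)=\zeta(w)=q$, replacing these occurrences of $q$ by $\ell$ and $r$ and adding to $D$, for each $p\in\mathrm{var}(r)$, the link between the new occurrences of $p$; or it replaces an occurrence of a state $q$ in $\xi$, at a position that is not linked to a state occurrence of $\zeta$, by a tree of $c(q)$. $M$ computes the relation of all $(t,u)\in T_\Sigma\times T_\Delta$ such that $\langle q,\{(\varepsilon,\varepsilon)\},q\rangle\Rightarrow_M^*\langle t,D,u\rangle$ for some $q\in I$ and some $D$. $M$ is an l-xt (no look-ahead) if $c(q)=T_\Sigma$ for all $q$; it is *$\varepsilon$-free* ($\not\varepsilon$) if $\ell\notin Q$, *strict* (s) if $r\notin Q$, and *nondeleting* (n) if $\mathrm{var}(r)=\mathrm{var}(\ell)$, for every rule $(\ell,q,r)\in R$. Writing XT in place of xt denotes the class of relations computed by the transducers with the indicated properties; [s][n] means that each of the restrictions s and n may be imposed or not (consistently on both sides). **Theorem.** For every $n\ge 1$, $$\mathrm B(\mathrm l,\mathrm c)^n\subsetneq \mathrm B(\mathrm l,\mathrm c)^{n+1},\qquad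 (\not\varepsilon\text{nl-XT})^n\subsetneq(\not\varepsilon\text{nl-XT})^{n+1},$$ $$(\text{[s][n]l-XT})^n\subsetneq(\text{[s][n]l-XT})^{n+1},\qquad (\text{[s][n]l-XT}^{\mathrm R})^n\subsetneq(\text{[s][n]l-XT}^{\mathrm R})^{n+1}.$$ -/

import Mathlib

namespace TreeTrans

/-- A ranked alphabet: a nonempty finite set of symbols, each with a rank. -/
structure RankedAlphabet where
  Symbol : Type
  [nonempty : Nonempty Symbol]
  [finite : Finite Symbol]
  rk : Symbol → ℕ

/-- `Tree A S` is the set `T_A(S)` of trees over the ranked alphabet `A` with leaf labels `S`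
(the leaf labels are disjoint from the symbols of `A` by construction). -/
inductive Tree (A : RankedAlphabet) (S : Type) : Type
  | leaf (s : S) : Tree A S
  | node (σ : A.Symbol) (ts : Fin (A.rk σ) → Tree A S) : Tree A S

/-- `T_A`, the trees over `A` without extra leaf labels. -/
abbrev GTree (A : RankedAlphabet) : Type := Tree A Empty

namespace Tree

variable {A : RankedAlphabet} {S U : Type}

/-- Substitution: every leaf labelled `s` is replaced by `f s`. -/
def subst (f : S → Tree A U) : Tree A S → Tree A U
  | leaf s => f s
  | node σ ts => node σ (fun i => subst f (ts i))

/-- The inclusion `T_A ⊆ T_A(S)`. -/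
def incl (t : GTree A) : Tree A S := t.subst Empty.elim

/-- The subtree `t|_w` at `w`; it is `none` if `w` is not a position of `t`.
Positions are words over `ℕ`; the direct subtrees are numbered from `0`. -/
def subtreeAt : List ℕ → Tree A S → Option (Tree A S)
  | [], t => some t
  | _ :: _, leaf _ => none
  | i :: w, node σ ts => if h : i < A.rk σ then subtreeAt w (ts ⟨i, h⟩) else none

/-- `t.replaceAt w u` is the tree `t[u]_w`, obtained from `t` by replacing the subtree at
position `w` by `u` (only used for positions `w` of `t`). -/
def replaceAt : List ℕ → Tree A S → Tree A S → Tree A S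
  | [], _, u => u
  | _ :: _, leaf s, _ => leaf s
  | i :: w, node σ ts, u => node σ (fun j => if (j : ℕ) = i then replaceAt w (ts j) u else ts j)

/-- `pos_s(t)`, the set of positions of `t` that are labelled by the leaf label `s`. -/
def posOf (s : S) (t : Tree A S) : Set (List ℕ) := {w | subtreeAt w t = some (leaf s)}

/-- `var(t)`, the set of leaf labels that occur in `t`. -/
def var (t : Tree A S) : Set S := {s | (t.posOf s).Nonempty}

/-- `t` is linear: every leaf label occurs at most once. -/
def Linear (t : Tree A S) : Prop := ∀ s, (t.posOf s).Subsingleton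

/-- `t` is nondeleting: every leaf label occurs at least once. -/
def Nondeleting (t : Tree A S) : Prop := ∀ s, (t.posOf s).Nonempty

/-- `t` is a single leaf, i.e. an element of `S`. -/
def IsLeaf (t : Tree A S) : Prop := ∃ s, t = leaf s

end Tree

/-! ### Regular tree languages -/

/-- A finite (deterministic, total, bottom-up) tree automaton. -/
structure TreeAutomaton (A : RankedAlphabet) where
  State : Type
  [finite : Finite State]
  δ : (σ : A.Symbol) → (Fin (A.rk σ) → State) → State
  final : Set State

/-- The state that the automaton reaches at the root of a tree. -/
def TreeAutomaton.eval {A : RankedAlphabet} (N : TreeAutomaton A) : GTree A → N.State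
  | .leaf e => e.elim
  | .node σ ts => N.δ σ (fun i => N.eval (ts i))

/-- The tree language recognized by the automaton. -/
def TreeAutomaton.language {A : RankedAlphabet} (N : TreeAutomaton A) : Set (GTree A) :=
  {t | N.eval t ∈ N.final}

/-- Regular tree languages. -/
def IsRegular {A : RankedAlphabet} (L : Set (GTree A)) : Prop :=
  ∃ N : TreeAutomaton A, N.language = L

/-! ### Classes of tree transformations, composition and powers -/

/-- A class of tree transformations: for all ranked alphabets `A` and `B` it has a set of
relations from `T_A` to `T_B`.  Inclusion `≤` and strict inclusion `<` of classes are the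
pointwise order on such families and its strict part. -/
abbrev TransClass : Type 1 := ∀ A B : RankedAlphabet, Set (SetRel (GTree A) (GTree B))

/-- The composition `C₁ ; C₂ = {R₁ ; R₂ | R₁ ∈ C₁, R₂ ∈ C₂}` of two classes, where
`R₁ ; R₂ = {(s, u) | ∃ t, (s, t) ∈ R₁ ∧ (t, u) ∈ R₂}`. -/
def TransClass.comp (C₁ C₂ : TransClass) : TransClass := fun A B =>
  {R | ∃ (D : RankedAlphabet) (R₁ : SetRel (GTree A) (GTree D)) (R₂ : SetRel (GTree D) (GTree B)),
    R₁ ∈ C₁ A D ∧ R₂ ∈ C₂ D B ∧ R = SetRel.comp R₁ R₂}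

/-- The powers `C¹ = C` and `Cⁿ⁺¹ = Cⁿ ; C` for `n ≥ 1` (the value at `0` is irrelevant). -/
def TransClass.power (C : TransClass) : ℕ → TransClass
  | 0 => fun _ _ => ∅
  | 1 => C
  | n + 2 => (TransClass.power C (n + 1)).comp C

/-! ### Tree homomorphisms and bimorphisms -/

/-- A tree homomorphism from `G` to `A` maps every symbol of rank `k` to a tree over `A` with
leaf labels `x_1, …, x_k`. -/
def TreeHom (G A : RankedAlphabet) : Type := (γ : G.Symbol) → Tree A (Fin (G.rk γ))

namespace TreeHom

variable {G A : RankedAlphabet}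

/-- The induced mapping on trees. -/
def apply (h : TreeHom G A) {S : Type} : Tree G S → Tree A S
  | .leaf s => .leaf s
  | .node γ ts => (h γ).subst (fun i => h.apply (ts i))

def Linear (h : TreeHom G A) : Prop := ∀ γ, (h γ).Linear

def Complete (h : TreeHom G A) : Prop := ∀ γ, (h γ).Nondeleting

end TreeHom

/-- A bimorphism `(ψ, L, φ)` with input alphabet `A` and output alphabet `B`. -/
structure Bimorphism (A B : RankedAlphabet) where
  center : RankedAlphabet
  input : TreeHom center A
  L : Set (GTree center)
  regular : IsRegular L
  output : TreeHom center B

/-- The tree transformation `{(ψ(t), φ(t)) | t ∈ L}` computed by a bimorphism. -/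
def Bimorphism.transformation {A B : RankedAlphabet} (M : Bimorphism A B) :
    SetRel (GTree A) (GTree B) :=
  {p | ∃ t ∈ M.L, p = (M.input.apply t, M.output.apply t)}

/-- The class `B(l, c)`: bimorphisms with linear input and complete output homomorphism. -/
def BLC : TransClass := fun A B =>
  {τ | ∃ M : Bimorphism A B, M.input.Linear ∧ M.output.Complete ∧ M.transformation = τ}

/-! ### Linear extended top-down tree transducers with regular look-ahead -/

/-- A rule `(ℓ, q, r)`. -/
structure Rule (A B : RankedAlphabet) (Q : Type) where
  lhs : Tree A Q
  state : Q
  rhs : Tree B Q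

/-- A linear extended top-down tree transducer with regular look-ahead. -/
structure LXTR (A B : RankedAlphabet) where
  State : Type
  [finite : Finite State]
  initial : Set State
  rules : Set (Rule A B State)
  rules_finite : rules.Finite
  lhs_linear : ∀ ρ ∈ rules, ρ.lhs.Linear
  rhs_linear : ∀ ρ ∈ rules, ρ.rhs.Linear
  var_subset : ∀ ρ ∈ rules, ρ.rhs.var ⊆ ρ.lhs.var
  lookahead : State → Set (GTree A)
  lookahead_regular : ∀ q, IsRegular (lookahead q)

/-- A link structure: a relation between input and output positions. -/
abbrev LinkStruct : Type := Set (List ℕ × List ℕ)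

/-- The explicit link structure of a rule for the positions `v` and `w`. -/
def Rule.links {A B : RankedAlphabet} {Q : Type} (ρ : Rule A B Q) (v w : List ℕ) : LinkStruct :=
  {x | ∃ p, ∃ a ∈ ρ.lhs.posOf p, ∃ b ∈ ρ.rhs.posOf p, x = (v ++ a, w ++ b)}

/-- A sentential form: input tree, links, output tree.  The initial forms below only link
positions of the two trees, and derivation steps preserve this. -/
structure SentForm (A B : RankedAlphabet) (Q : Type) where
  input : Tree A Q
  links : LinkStruct
  output : Tree B Q

namespace LXTR

variable {A B : RankedAlphabet}

/-- The derivation relation: a rule is applied to a linked pair of occurrences of its state, or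
an occurrence of a state that is not linked to any state in the output tree is replaced by a tree
of its look-ahead. -/
inductive Step (M : LXTR A B) : SentForm A B M.State → SentForm A B M.State → Prop
  | rule (X : SentForm A B M.State) (ρ : Rule A B M.State) (v w : List ℕ)
      (hρ : ρ ∈ M.rules) (hlink : (v, w) ∈ X.links)
      (hv : v ∈ X.input.posOf ρ.state) (hw : w ∈ X.output.posOf ρ.state) :
      Step M X ⟨X.input.replaceAt v ρ.lhs, X.links ∪ ρ.links v w, X.output.replaceAt w ρ.rhs⟩
  | look (X : SentForm A B M.State) (q : M.State) (v : List ℕ) (t : GTree A)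
      (hv : v ∈ X.input.posOf q)
      (hunlinked : ∀ w, (v, w) ∈ X.links → ∀ p, w ∉ X.output.posOf p)
      (ht : t ∈ M.lookahead q) :
      Step M X ⟨X.input.replaceAt v t.incl, X.links, X.output⟩

/-- The dependencies computed by `M`. -/
def dep (M : LXTR A B) : Set (GTree A × LinkStruct × GTree B) :=
  {x | ∃ q ∈ M.initial, Relation.ReflTransGen M.Step
    ⟨.leaf q, {([], [])}, .leaf q⟩ ⟨x.1.incl, x.2.1, x.2.2.incl⟩}

/-- The tree transformation computed by `M`. -/
def transformation (M : LXTR A B) : SetRel (GTree A) (GTree B) :=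
  {p | ∃ D : LinkStruct, (p.1, D, p.2) ∈ M.dep}

/-- No look-ahead: `M` is an l-xt. -/
def NoLookahead (M : LXTR A B) : Prop := ∀ q, M.lookahead q = Set.univ

def EpsFree (M : LXTR A B) : Prop := ∀ ρ ∈ M.rules, ¬ ρ.lhs.IsLeaf

def Strict (M : LXTR A B) : Prop := ∀ ρ ∈ M.rules, ¬ ρ.rhs.IsLeaf

def Nondeleting (M : LXTR A B) : Prop := ∀ ρ ∈ M.rules, ρ.rhs.var = ρ.lhs.var

end LXTR

/-- The class [ε-free][s][n]l-XT with regular look-ahead; each restriction is imposed if and only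
if its flag is `true`. -/
def lXTR (epsFree strict nondel : Bool) : TransClass := fun A B =>
  {τ | ∃ M : LXTR A B, (epsFree = true → M.EpsFree) ∧ (strict = true → M.Strict) ∧
    (nondel = true → M.Nondeleting) ∧ M.transformation = τ}

/-- The class [ε-free][s][n]l-XT (without look-ahead); each restriction is imposed if and only
if its flag is `true`. -/
def lXT (epsFree strict nondel : Bool) : TransClass := fun A B =>
  {τ | ∃ M : LXTR A B, M.NoLookahead ∧ (epsFree = true → M.EpsFree) ∧ (strict = true → M.Strict) ∧
    (nondel = true → M.Nondeleting) ∧ M.transformation = τ}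

end TreeTrans

/-! The invariant is the nesting depth of branching. A bush of level `j` is a path with many
branching points, each carrying off the path a bush of level `j - 1`. One transducer can lower this
level by only one when passing from output to input. A right-hand side `r` has bounded height, so a
long path must leave it, and so must the path of a side bush of positive level that branches off
inside `r`. Linearity makes the two exit leaves different, and both occur in the left-hand side, so
the input branches there too. At most a fixed number of branching points is merged into one, and
only side bushes of level `0`, which may fit inside `r`, are lost (`LinkedPair.bush`).

This estimate composes (`BushLowering.comp`): a relation in the `n`-th power lowers levels by at
most `n`. On the other side, a single transducer with insertion rules turns combs nested to depth
`j` into combs nested to depth `j + 1`. Its `(n + 1)`-fold composition takes a single nullary node,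
which has no bush of positive level and positive count, to combs of depth `n + 1`, so it does not
lie in the `n`-th power (`not_bushLowering`).

For `BLC` and the ε-free nondeleting class the same argument runs from input to output: it is now
the input side that is linear and of bounded height, and the output keeps all its variables.
Strictness of each inclusion then comes from the reversed nested-comb chain, while the inclusion
itself holds because identities belong to every class. -/

namespace TreeTrans

/-! ### Occurrences of leaf labels, linearity, substitution and height. -/

namespace Tree

variable {A : RankedAlphabet} {S U : Type}

theorem subst_leaf (f : S → Tree A U) (s : S) : (leaf s).subst f = f s := rfl

theorem subst_node (f : S → Tree A U) (σ : A.Symbol) (ts : Fin (A.rk σ) → Tree A S) :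
    (node σ ts).subst f = node σ (fun i => (ts i).subst f) := rfl

theorem posOf_leaf (s s' : S) : (leaf s' : Tree A S).posOf s = {w | w = [] ∧ s' = s} := by
  ext w
  cases w <;> simp [posOf, subtreeAt]

theorem nil_notMem_posOf_node (s : S) (σ : A.Symbol) (ts : Fin (A.rk σ) → Tree A S) :
    [] ∉ (node σ ts).posOf s := by
  simp [posOf, subtreeAt]

theorem cons_mem_posOf_node (s : S) (σ : A.Symbol) (ts : Fin (A.rk σ) → Tree A S) (i : ℕ)
    (w : List ℕ) :
    i :: w ∈ (node σ ts).posOf s ↔ ∃ h : i < A.rk σ, w ∈ (ts ⟨i, h⟩).posOf s := by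
  simp only [posOf, subtreeAt, Set.mem_ofPred_eq]
  split_ifs with h <;> simp [h]

theorem mem_var_leaf {s s' : S} : s ∈ (leaf s' : Tree A S).var ↔ s = s' := by
  simp only [var, Set.mem_ofPred_eq, posOf_leaf]
  exact ⟨fun ⟨_, _, h⟩ => h.symm, fun h => ⟨[], rfl, h.symm⟩⟩

theorem mem_var_node {s : S} {σ : A.Symbol} {ts : Fin (A.rk σ) → Tree A S} :
    s ∈ (node σ ts).var ↔ ∃ i, s ∈ (ts i).var := by
  constructor
  · rintro ⟨w, hw⟩
    cases w with
    | nil => exact absurd hw (nil_notMem_posOf_node _ _ _)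
    | cons i w =>
      obtain ⟨h, hw⟩ := (cons_mem_posOf_node _ _ _ _ _).1 hw
      exact ⟨⟨i, h⟩, w, hw⟩
  · rintro ⟨i, w, hw⟩
    exact ⟨i :: w, (cons_mem_posOf_node _ _ _ _ _).2 ⟨i.2, hw⟩⟩

theorem linear_leaf (s : S) : (leaf s : Tree A S).Linear := by
  intro s' a ha b hb
  rw [posOf_leaf] at ha hb
  rw [ha.1, hb.1]

theorem Linear.child {σ : A.Symbol} {ts : Fin (A.rk σ) → Tree A S} (h : (node σ ts).Linear)
    (i : Fin (A.rk σ)) : (ts i).Linear := by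
  intro s a ha b hb
  have := h s ((cons_mem_posOf_node s σ ts i a).2 ⟨i.2, ha⟩)
    ((cons_mem_posOf_node s σ ts i b).2 ⟨i.2, hb⟩)
  exact (List.cons.inj this).2

theorem Linear.child_unique {σ : A.Symbol} {ts : Fin (A.rk σ) → Tree A S}
    (h : (node σ ts).Linear) {s : S} {i j : Fin (A.rk σ)} (hi : s ∈ (ts i).var)
    (hj : s ∈ (ts j).var) : i = j := by
  obtain ⟨a, ha⟩ := hi
  obtain ⟨b, hb⟩ := hj
  have := h s ((cons_mem_posOf_node s σ ts i a).2 ⟨i.2, ha⟩)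
    ((cons_mem_posOf_node s σ ts j b).2 ⟨j.2, hb⟩)
  exact Fin.ext (List.cons.inj this).1

theorem linear_node {σ : A.Symbol} {ts : Fin (A.rk σ) → Tree A S} (h : ∀ i, (ts i).Linear)
    (h' : ∀ i j s, s ∈ (ts i).var → s ∈ (ts j).var → i = j) : (node σ ts).Linear := by
  intro s a ha b hb
  cases a with
  | nil => exact absurd ha (nil_notMem_posOf_node _ _ _)
  | cons i a =>
    cases b with
    | nil => exact absurd hb (nil_notMem_posOf_node _ _ _)
    | cons j b =>
      obtain ⟨hi, ha⟩ := (cons_mem_posOf_node _ _ _ _ _).1 ha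
      obtain ⟨hj, hb⟩ := (cons_mem_posOf_node _ _ _ _ _).1 hb
      obtain rfl : i = j := Fin.mk.inj_iff.1 (h' ⟨i, hi⟩ ⟨j, hj⟩ s ⟨a, ha⟩ ⟨b, hb⟩)
      rw [h _ s ha hb]

theorem subst_congr {f g : S → Tree A U} (t : Tree A S) (h : ∀ s ∈ t.var, f s = g s) :
    t.subst f = t.subst g := by
  induction t with
  | leaf s => exact h s (mem_var_leaf.2 rfl)
  | node σ ts ih =>
    simp only [subst_node]
    congr 1
    funext i
    exact ih i fun s hs => h s (mem_var_node.2 ⟨i, hs⟩)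

theorem subst_subst {V : Type} (f : S → Tree A U) (g : U → Tree A V) (t : Tree A S) :
    (t.subst f).subst g = t.subst (fun s => (f s).subst g) := by
  induction t with
  | leaf s => rfl
  | node σ ts ih => simp only [subst_node, ih]

theorem subst_leaf_eq_self (t : Tree A S) : t.subst leaf = t := by
  induction t with
  | leaf s => rfl
  | node σ ts ih => simp only [subst_node, ih]

theorem subst_ground (f : Empty → GTree A) (t : GTree A) : t.subst f = t := by
  rw [← subst_leaf_eq_self t, subst_subst]
  exact subst_congr _ fun s _ => s.elim

/-- The height of a tree; leaves with extra labels have height `0`. -/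
def height : Tree A S → ℕ
  | leaf _ => 0
  | node _ ts => (Finset.univ.sup fun i => (ts i).height) + 1

theorem height_child_lt (σ : A.Symbol) (ts : Fin (A.rk σ) → Tree A S) (i : Fin (A.rk σ)) :
    (ts i).height < (node σ ts).height :=
  Nat.lt_succ_of_le (Finset.le_sup (f := fun i => (ts i).height) (Finset.mem_univ i))

end Tree

/-! ### Bushes and their transport along linked pairs. -/

open TreeTrans.Tree

/-- `Bush m j k t`: some path in `t` has `k` branching points, and off the path there hangs at each
of them a subtree that contains in the same sense a bush of level `j - 1` with `m` branching
points; every tree contains a bush of level `0`. -/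
inductive Bush (m : ℕ) {A : RankedAlphabet} : ℕ → ℕ → GTree A → Prop
  | level_zero (k : ℕ) (t : GTree A) : Bush m 0 k t
  | count_zero (j : ℕ) (t : GTree A) : Bush m j 0 t
  | down {j k : ℕ} {σ : A.Symbol} {ts : Fin (A.rk σ) → GTree A} (i : Fin (A.rk σ)) :
      Bush m j k (ts i) → Bush m j k (.node σ ts)
  | branch {j k : ℕ} {σ : A.Symbol} {ts : Fin (A.rk σ) → GTree A} (i i' : Fin (A.rk σ)) :
      i ≠ i' → Bush m (j + 1) k (ts i) → Bush m j m (ts i') → Bush m (j + 1) (k + 1) (.node σ ts)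

namespace Bush

variable {A : RankedAlphabet} {S : Type} {m : ℕ}

theorem subst {l : Tree A S} {f : S → GTree A} {p : S} (hp : p ∈ l.var) {j k : ℕ}
    (h : Bush m j k (f p)) : Bush m j k (l.subst f) := by
  induction l with
  | leaf s => rw [mem_var_leaf.1 hp] at h; exact h
  | node σ ts ih =>
    obtain ⟨i, hi⟩ := mem_var_node.1 hp
    exact down i (ih i hi)

/-- The paths to the two leaves separate at some node of `l`, which becomes the new branching point.
-/
theorem subst_branch {l : Tree A S} {f : S → GTree A} {p p' : S} (hp : p ∈ l.var)
    (hp' : p' ∈ l.var) (hne : p ≠ p') {j k : ℕ} (h : Bush m (j + 1) k (f p))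
    (h' : Bush m j m (f p')) : Bush m (j + 1) (k + 1) (l.subst f) := by
  induction l with
  | leaf s => exact absurd ((mem_var_leaf.1 hp).trans (mem_var_leaf.1 hp').symm) hne
  | node σ ts ih =>
    obtain ⟨i, hi⟩ := mem_var_node.1 hp
    obtain ⟨i', hi'⟩ := mem_var_node.1 hp'
    by_cases hii : i = i'
    · subst hii
      exact down i (ih i hi hi')
    · exact branch i i' hii (h.subst hi) (h'.subst hi')

/-- Each node of `r` on the path uses up at most one branching point, so a path with more of them
than the height of `r` leaves `r` through some leaf `p`. -/
theorem exists_var {r : Tree A S} {g : S → GTree A} {j k : ℕ}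
    (h : Bush m (j + 1) k (r.subst g)) (hk : r.height < k) :
    ∃ p ∈ r.var, ∃ k₁, k ≤ k₁ + r.height ∧ Bush m (j + 1) k₁ (g p) := by
  induction r generalizing k with
  | leaf s => exact ⟨s, mem_var_leaf.2 rfl, k, le_rfl, h⟩
  | node σ ts ih =>
    rw [subst_node] at h
    cases h with
    | count_zero => exact absurd hk (Nat.not_lt_zero _)
    | down i h =>
      have := height_child_lt σ ts i
      obtain ⟨p, hp, k₁, hk₁, hb⟩ := ih i h (this.trans hk)
      exact ⟨p, mem_var_node.2 ⟨i, hp⟩, k₁, by omega, hb⟩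
    | branch i i' _ h _ =>
      have := height_child_lt σ ts i
      obtain ⟨p, hp, k₁, hk₁, hb⟩ := ih i h (by omega)
      exact ⟨p, mem_var_node.2 ⟨i, hp⟩, k₁, by omega, hb⟩

/-- Either the path crosses `r` without branching and no count is lost, or it has a first branching
point inside `r`. The side bush there still has positive level, so `exists_var` applies to it as
well; level `j + 2` is needed for this. Linearity separates the two exit leaves. -/
theorem exists_var_or_branch {r : Tree A S} (hr : r.Linear) {g : S → GTree A} {j k : ℕ}
    (h : Bush m (j + 2) k (r.subst g)) (hk : r.height < k) (hm : r.height < m) :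
    ∃ p ∈ r.var, Bush m (j + 2) k (g p) ∨
      ∃ p' ∈ r.var, p ≠ p' ∧ (∃ k₁, k ≤ k₁ + r.height ∧ Bush m (j + 2) k₁ (g p)) ∧
        ∃ k₂, m ≤ k₂ + r.height ∧ Bush m (j + 1) k₂ (g p') := by
  induction r generalizing k with
  | leaf s => exact ⟨s, mem_var_leaf.2 rfl, Or.inl h⟩
  | node σ ts ih =>
    rw [subst_node] at h
    cases h with
    | count_zero => exact absurd hk (Nat.not_lt_zero _)
    | down i h =>
      have := height_child_lt σ ts i
      obtain ⟨p, hp, hb | ⟨p', hp', hne, ⟨k₁, hk₁, h₁⟩, k₂, hk₂, h₂⟩⟩ :=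
        ih i (hr.child i) h (this.trans hk) (this.trans hm)
      · exact ⟨p, mem_var_node.2 ⟨i, hp⟩, Or.inl hb⟩
      · exact ⟨p, mem_var_node.2 ⟨i, hp⟩, Or.inr ⟨p', mem_var_node.2 ⟨i, hp'⟩, hne,
          ⟨k₁, by omega, h₁⟩, k₂, by omega, h₂⟩⟩
    | branch i i' hii h h' =>
      have := height_child_lt σ ts i
      have := height_child_lt σ ts i'
      obtain ⟨p, hp, k₁, hk₁, h₁⟩ := h.exists_var (by omega)
      obtain ⟨p', hp', k₂, hk₂, h₂⟩ := h'.exists_var (by omega)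
      refine ⟨p, mem_var_node.2 ⟨i, hp⟩, Or.inr ⟨p', mem_var_node.2 ⟨i', hp'⟩, ?_,
          ⟨k₁, by omega, h₁⟩, k₂, by omega, h₂⟩⟩
      rintro rfl
      exact hii (hr.child_unique hp hp')

end Bush

/-- Pairs of trees that develop in parallel: the second one by linear trees of height at most `K`,
the first one by trees that contain at least the same leaf labels. -/
inductive LinkedPair (K : ℕ) {A B : RankedAlphabet} : GTree A → GTree B → Prop
  | mk {S : Type} (l : Tree A S) (r : Tree B S) (f : S → GTree A) (g : S → GTree B)
      (linear : r.Linear) (var_subset : r.var ⊆ l.var) (height_le : r.height ≤ K)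
      (h : ∀ p ∈ r.var, LinkedPair K (f p) (g p)) : LinkedPair K (l.subst f) (r.subst g)

/-- A crossing in which branching points are lost costs at most `K` of them and yields one branching
point in `t`; this is why counts are divided by `K + 1`. The side count `(K + 1) * m + K + 1`
exceeds `K`, so side paths leave `r`, and at least `(K + 1) * m` of it remains afterwards. -/
theorem LinkedPair.bush {K m : ℕ} {A B : RankedAlphabet} {t : GTree A} {u : GTree B}
    (h : LinkedPair K t u) {j k k' : ℕ} (hk : (K + 1) * k' ≤ k)
    (hu : Bush ((K + 1) * m + K + 1) (j + 1) k u) : Bush m j k' t := by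
  induction h generalizing j k k' with
  | mk l r f g linear var_subset height_le _ ih =>
    cases j with
    | zero => exact .level_zero _ _
    | succ j =>
      cases k' with
      | zero => exact .count_zero _ _
      | succ k' =>
        rw [Nat.mul_succ] at hk
        obtain ⟨p, hp, hb | ⟨p', hp', hne, ⟨k₁, hk₁, h₁⟩, k₂, hk₂, h₂⟩⟩ :=
          hu.exists_var_or_branch linear (by omega) (by omega)
        · exact (ih p hp (by rwa [Nat.mul_succ]) hb).subst (var_subset hp)
        · exact Bush.subst_branch (var_subset hp) (var_subset hp') hne
            (ih p hp (by omega) h₁) (ih p' hp' (by omega) h₂)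

/-- Along `R` the level of bushes decreases by at most `n` from right to left. -/
def BushLowering (n : ℕ) {A B : RankedAlphabet} (R : SetRel (GTree A) (GTree B)) : Prop :=
  ∀ m, ∃ M, ∀ t u, (t, u) ∈ R → ∀ j, Bush M (j + n) M u → Bush m j m t

theorem bushLowering_one {K : ℕ} {A B : RankedAlphabet} {R : SetRel (GTree A) (GTree B)}
    (h : ∀ t u, (t, u) ∈ R → LinkedPair K t u) : BushLowering 1 R := fun m =>
  ⟨(K + 1) * m + K + 1, fun t u htu _ hu => (h t u htu).bush (by omega) hu⟩

theorem BushLowering.comp {n k : ℕ} {A B C : RankedAlphabet} {R₁ : SetRel (GTree A) (GTree B)}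
    {R₂ : SetRel (GTree B) (GTree C)} (h₁ : BushLowering n R₁) (h₂ : BushLowering k R₂) :
    BushLowering (n + k) (R₁.comp R₂) := by
  intro m
  obtain ⟨M₁, h₁⟩ := h₁ m
  obtain ⟨M₂, h₂⟩ := h₂ M₁
  refine ⟨M₂, ?_⟩
  rintro t u ⟨s, hts, hsu⟩ j hu
  exact h₁ t s hts j (h₂ s u hsu (j + n) (by rwa [Nat.add_assoc]))

/-! ### Powers of classes -/

theorem TransClass.power_induction {C : TransClass}
    (P : ℕ → ∀ {A B : RankedAlphabet}, SetRel (GTree A) (GTree B) → Prop)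
    (one : ∀ {A B : RankedAlphabet}, ∀ R ∈ C A B, P 1 R)
    (comp : ∀ {n : ℕ} {A B D : RankedAlphabet} {R₁ : SetRel (GTree A) (GTree B)}
      {R₂ : SetRel (GTree B) (GTree D)}, P n R₁ → P 1 R₂ → P (n + 1) (R₁.comp R₂))
    {n : ℕ} {A B : RankedAlphabet} {R : SetRel (GTree A) (GTree B)} (hR : R ∈ C.power n A B) :
    P n R := by
  induction n generalizing A B with
  | zero => exact hR.elim
  | succ n ih =>
    cases n with
    | zero => exact one R hR
    | succ n =>
      obtain ⟨D, R₁, R₂, h₁, h₂, rfl⟩ := hR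
      exact comp (ih h₁) (one R₂ h₂)

theorem TransClass.power_le_power_succ {C : TransClass} (hid : ∀ A, SetRel.id ∈ C A A) {n : ℕ}
    (hn : 1 ≤ n) : C.power n ≤ C.power (n + 1) := by
  obtain ⟨n, rfl⟩ : ∃ k, n = k + 1 := ⟨n - 1, by omega⟩
  exact fun A B R hR => ⟨B, R, SetRel.id, hR, hid B, (SetRel.comp_id R).symm⟩

/-- One relation `R` has to serve all chains, since the combs below have unbounded length `m`. -/
theorem TransClass.exists_mem_power {C : TransClass} {A : RankedAlphabet}
    {τ : SetRel (GTree A) (GTree A)} (hτ : τ ∈ C A A) (n : ℕ) :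
    ∃ R ∈ C.power (n + 1) A A, ∀ s : ℕ → GTree A, (∀ i ≤ n, (s i, s (i + 1)) ∈ τ) →
      (s 0, s (n + 1)) ∈ R := by
  induction n with
  | zero => exact ⟨τ, hτ, fun s hs => hs 0 le_rfl⟩
  | succ n ih =>
    obtain ⟨R, hR, h⟩ := ih
    exact ⟨R.comp τ, ⟨A, R, τ, hR, hτ, rfl⟩, fun s hs =>
      ⟨s (n + 1), h s fun i hi => hs i (by omega), hs (n + 1) le_rfl⟩⟩

/-! ### Nested combs -/

/-- The alphabet with a binary symbol `true` and a nullary symbol `false`. -/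
def binaryAlphabet : RankedAlphabet where
  Symbol := Bool
  rk b := bif b then 2 else 0

namespace Tree

variable {S U : Type}

def nullary : Tree binaryAlphabet S := .node (A := binaryAlphabet) false Fin.elim0

def binary (a b : Tree binaryAlphabet S) : Tree binaryAlphabet S :=
  .node (A := binaryAlphabet) true fun i => if i.val = 0 then a else b

theorem subst_nullary (f : S → Tree binaryAlphabet U) : (nullary.subst f) = nullary :=
  congrArg (node (A := binaryAlphabet) false) (funext fun i => i.elim0)

theorem subst_binary (f : S → Tree binaryAlphabet U) (a b : Tree binaryAlphabet S) :
    (binary a b).subst f = binary (a.subst f) (b.subst f) :=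
  congrArg (node (A := binaryAlphabet) true)
    (funext fun i => apply_ite (fun t : Tree binaryAlphabet S => t.subst f) (i.val = 0) a b)

theorem mem_var_nullary {s : S} : s ∈ (nullary : Tree binaryAlphabet S).var ↔ False :=
  (mem_var_node (A := binaryAlphabet) (σ := false)).trans ⟨fun ⟨i, _⟩ => i.elim0, False.elim⟩

theorem mem_var_binary {s : S} {a b : Tree binaryAlphabet S} :
    s ∈ (binary a b).var ↔ s ∈ a.var ∨ s ∈ b.var := by
  refine (mem_var_node (A := binaryAlphabet) (σ := true)).trans ⟨?_, ?_⟩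
  · rintro ⟨i, hi⟩
    split_ifs at hi
    exacts [Or.inl hi, Or.inr hi]
  · rintro (h | h)
    exacts [⟨(0 : Fin 2), h⟩, ⟨(1 : Fin 2), h⟩]

theorem linear_nullary : (nullary : Tree binaryAlphabet S).Linear :=
  linear_node (A := binaryAlphabet) (fun i => i.elim0) fun i => i.elim0

theorem linear_binary {a b : Tree binaryAlphabet S} (ha : a.Linear) (hb : b.Linear)
    (h : ∀ s ∈ a.var, s ∉ b.var) : (binary a b).Linear := by
  refine linear_node (A := binaryAlphabet) (fun i => by split_ifs <;> assumption)
    fun i j s hi hj => ?_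
  have hi2 : i.val < 2 := i.2
  have hj2 : j.val < 2 := j.2
  split_ifs at hi hj with h₁ h₂ h₂
  · exact Fin.ext (h₁.trans h₂.symm)
  · exact absurd hj (h s hi)
  · exact absurd hi (h s hj)
  · exact Fin.ext (by omega)

/-- The right comb with `k` copies of `t` hanging off its spine, which ends in `t`, too. -/
def comb (t : GTree binaryAlphabet) : ℕ → GTree binaryAlphabet
  | 0 => t
  | k + 1 => binary t (comb t k)

/-- Combs of length `m`, nested to depth `j`. -/
def nestedComb (m : ℕ) : ℕ → GTree binaryAlphabet
  | 0 => nullary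
  | j + 1 => comb (nestedComb m j) m

end Tree

/-! ### Bushes in nested combs and the separation of consecutive powers. -/

theorem bush_comb {m j : ℕ} {t : GTree binaryAlphabet} (h : Bush m j m t) (k : ℕ) :
    Bush m (j + 1) k (comb t k) := by
  induction k with
  | zero => exact .count_zero _ _
  | succ k ih =>
    exact .branch (A := binaryAlphabet) (σ := true) (1 : Fin 2) (0 : Fin 2)
      (Fin.ne_of_val_ne Nat.one_ne_zero) ih h

theorem bush_nestedComb (m j : ℕ) : Bush m j m (nestedComb m j) := by
  induction j with
  | zero => exact .level_zero _ _
  | succ j ih => exact bush_comb ih m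

theorem not_bush_nullary (m j k : ℕ) : ¬ Bush m (j + 1) (k + 1) (nullary : GTree binaryAlphabet) := by
  intro h
  cases h with
  | down i _ => exact i.elim0
  | branch i _ _ _ _ => exact i.elim0

/-- Combs as long as the threshold `M` for one branching point would force a bush of level `1` and
count `1` into a single nullary node. -/
theorem not_bushLowering {n : ℕ} {R : SetRel (GTree binaryAlphabet) (GTree binaryAlphabet)}
    (h : ∀ m, (nestedComb m 0, nestedComb m (n + 1)) ∈ R) : ¬ BushLowering n R := by
  intro hR
  obtain ⟨M, hM⟩ := hR 1
  refine not_bush_nullary 1 0 0 (hM _ _ (h M) 1 ?_)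
  rw [Nat.add_comm]
  exact bush_nestedComb M (n + 1)

theorem TransClass.power_lt_of_bushLowering {C : TransClass} (hid : ∀ A, SetRel.id ∈ C A A)
    (hC : ∀ {A B : RankedAlphabet}, ∀ R ∈ C A B, BushLowering 1 R)
    {τ : SetRel (GTree binaryAlphabet) (GTree binaryAlphabet)} (hτ : τ ∈ C _ _)
    (h : ∀ m j, (nestedComb m j, nestedComb m (j + 1)) ∈ τ) {n : ℕ} (hn : 1 ≤ n) :
    C.power n < C.power (n + 1) := by
  refine lt_of_le_not_ge (power_le_power_succ hid hn) fun hle => ?_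
  obtain ⟨R, hR, hs⟩ := exists_mem_power hτ n
  exact not_bushLowering (fun m => hs (nestedComb m) fun i _ => h m i)
    (power_induction (fun n => BushLowering n) hC BushLowering.comp (hle _ _ hR))

theorem TransClass.power_lt_of_bushLowering_inv {C : TransClass} (hid : ∀ A, SetRel.id ∈ C A A)
    (hC : ∀ {A B : RankedAlphabet}, ∀ R ∈ C A B, BushLowering 1 R.inv)
    {τ : SetRel (GTree binaryAlphabet) (GTree binaryAlphabet)} (hτ : τ ∈ C _ _)
    (h : ∀ m j, (nestedComb m (j + 1), nestedComb m j) ∈ τ) {n : ℕ} (hn : 1 ≤ n) :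
    C.power n < C.power (n + 1) := by
  refine lt_of_le_not_ge (power_le_power_succ hid hn) fun hle => ?_
  obtain ⟨R, hR, hs⟩ := exists_mem_power hτ n
  have hmem (m : ℕ) : (nestedComb m 0, nestedComb m (n + 1)) ∈ R.inv := by
    -- The chain is run backwards, from depth `n + 1` down to depth `0`.
    have := hs (fun i => nestedComb m (n + 1 - i)) fun i hi => by
      have := h m (n - i)
      rwa [show n - i + 1 = n + 1 - i by omega, show n - i = n + 1 - (i + 1) by omega] at this
    simpa using this
  refine not_bushLowering hmem (power_induction (C := C) (fun n _ _ R => BushLowering n R.inv) hC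
    (fun h₁ h₂ => ?_) (hle _ _ hR))
  rw [SetRel.inv_comp, Nat.add_comm]
  exact h₂.comp h₁

end TreeTrans

namespace TreeTrans

/-! ### Positions -/

namespace Tree

variable {A : RankedAlphabet} {S U : Type}

/-- `w` is a position of `t`. -/
def IsPos (w : List ℕ) (t : Tree A S) : Prop := (subtreeAt w t).isSome

theorem isPos_nil (t : Tree A S) : IsPos [] t := rfl

theorem isPos_cons (σ : A.Symbol) (ts : Fin (A.rk σ) → Tree A S) (i : ℕ) (w : List ℕ) :
    IsPos (i :: w) (node σ ts) ↔ ∃ h : i < A.rk σ, IsPos w (ts ⟨i, h⟩) := by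
  simp only [IsPos, subtreeAt]
  split_ifs with h <;> simp [h]

theorem isPos_of_mem_posOf {s : S} {w : List ℕ} {t : Tree A S} (h : w ∈ t.posOf s) : IsPos w t := by
  rw [IsPos, show subtreeAt w t = _ from h]
  rfl

theorem posOf_unique {s s' : S} {w : List ℕ} {t : Tree A S} (h : w ∈ t.posOf s)
    (h' : w ∈ t.posOf s') : s = s' := by
  have : some (leaf s) = some (leaf s') := (show subtreeAt w t = _ from h).symm.trans h'
  exact leaf.inj (Option.some.inj this)

theorem eq_leaf_of_nil_mem_posOf {s : S} {t : Tree A S} (h : [] ∈ t.posOf s) : t = leaf s :=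
  Option.some.inj h

theorem eq_nil_of_isPos_append {s : S} {v a : List ℕ} {t : Tree A S} (hv : v ∈ t.posOf s)
    (h : IsPos (v ++ a) t) : a = [] := by
  induction v generalizing t with
  | nil =>
    rw [eq_leaf_of_nil_mem_posOf hv] at h
    cases a with
    | nil => rfl
    | cons i a => cases h
  | cons i v ih =>
    cases t with
    | leaf s' => cases hv
    | node σ ts =>
      obtain ⟨hi, hv⟩ := (cons_mem_posOf_node _ _ _ _ _).1 hv
      obtain ⟨_, h⟩ := (isPos_cons _ _ _ _).1 h
      exact ih hv h

theorem replaceAt_cons (σ : A.Symbol) (ts : Fin (A.rk σ) → Tree A S) (i : ℕ) (v : List ℕ)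
    (u : Tree A S) : replaceAt (i :: v) (node σ ts) u =
      node σ (fun j => if (j : ℕ) = i then replaceAt v (ts j) u else ts j) := rfl

theorem mem_posOf_replaceAt {s s' : S} {v w : List ℕ} {t u : Tree A S} (hv : v ∈ t.posOf s) :
    w ∈ (t.replaceAt v u).posOf s' ↔
      (∃ a, w = v ++ a ∧ a ∈ u.posOf s') ∨ (w ∈ t.posOf s' ∧ w ≠ v) := by
  induction v generalizing t w with
  | nil =>
    rw [eq_leaf_of_nil_mem_posOf hv, posOf_leaf]
    constructor
    · exact fun h => Or.inl ⟨w, rfl, h⟩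
    · rintro (⟨a, rfl, h⟩ | ⟨⟨h, _⟩, h'⟩)
      exacts [h, absurd h h']
  | cons i v ih =>
    cases t with
    | leaf s' => cases hv
    | node σ ts =>
      obtain ⟨hi, hv⟩ := (cons_mem_posOf_node _ _ _ _ _).1 hv
      rw [replaceAt_cons]
      cases w with
      | nil => simp [nil_notMem_posOf_node]
      | cons k w =>
        rw [cons_mem_posOf_node, cons_mem_posOf_node]
        by_cases hk : k = i
        · subst hk
          simp only [if_true, hi, exists_true_left, ih hv, List.cons_append, List.cons.injEq,
            true_and, ne_eq]
        · simp [hk]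

theorem IsPos.replaceAt {s : S} {v w : List ℕ} {t : Tree A S} (hw : IsPos w t)
    (hv : v ∈ t.posOf s) (u : Tree A S) : IsPos w (t.replaceAt v u) := by
  induction v generalizing t w with
  | nil =>
    rw [eq_leaf_of_nil_mem_posOf hv] at hw
    cases w with
    | nil => exact isPos_nil _
    | cons i a => cases hw
  | cons i v ih =>
    cases t with
    | leaf s' => cases hv
    | node σ ts =>
      obtain ⟨hi, hv⟩ := (cons_mem_posOf_node _ _ _ _ _).1 hv
      cases w with
      | nil => exact isPos_nil _
      | cons k w =>
        obtain ⟨hk, hw⟩ := (isPos_cons _ _ _ _).1 hw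
        rw [replaceAt_cons, isPos_cons]
        refine ⟨hk, ?_⟩
        by_cases hki : k = i
        · subst hki
          simpa using ih hw hv
        · simpa [hki] using hw

theorem IsPos.append_replaceAt {s : S} {v a : List ℕ} {t u : Tree A S} (ha : IsPos a u)
    (hv : v ∈ t.posOf s) : IsPos (v ++ a) (t.replaceAt v u) := by
  induction v generalizing t with
  | nil => exact ha
  | cons i v ih =>
    cases t with
    | leaf s' => cases hv
    | node σ ts =>
      obtain ⟨hi, hv⟩ := (cons_mem_posOf_node _ _ _ _ _).1 hv
      rw [replaceAt_cons, List.cons_append, isPos_cons]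
      exact ⟨hi, by simpa using ih hv⟩

theorem replaceAt_append {s : S} {v a : List ℕ} {t u u' : Tree A S} (hv : v ∈ t.posOf s) :
    (t.replaceAt v u).replaceAt (v ++ a) u' = t.replaceAt v (u.replaceAt a u') := by
  induction v generalizing t with
  | nil => rfl
  | cons i v ih =>
    cases t with
    | leaf s' => cases hv
    | node σ ts =>
      obtain ⟨hi, hv⟩ := (cons_mem_posOf_node _ _ _ _ _).1 hv
      simp only [replaceAt_cons, List.cons_append]
      congr 1
      funext j
      split_ifs with hj
      · exact ih (by subst hj; exact hv)
      · rfl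

theorem mem_posOf_subst {s : S} {a : List ℕ} {t : Tree A S} (ha : a ∈ t.posOf s)
    {f : S → Tree A U} {s' : U} (hf : f s = leaf s') : a ∈ (t.subst f).posOf s' := by
  induction a generalizing t with
  | nil =>
    rw [eq_leaf_of_nil_mem_posOf ha, subst_leaf, hf]
    rfl
  | cons i a ih =>
    cases t with
    | leaf s' => cases ha
    | node σ ts =>
      obtain ⟨hi, ha⟩ := (cons_mem_posOf_node _ _ _ _ _).1 ha
      exact (cons_mem_posOf_node _ _ _ _ _).2 ⟨hi, ih ha⟩

theorem Linear.replaceAt_subst [DecidableEq S] {s : S} {a : List ℕ} {t : Tree A S}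
    (ht : t.Linear) (ha : a ∈ t.posOf s) (f : S → Tree A U) (u : Tree A U) :
    (t.subst f).replaceAt a u = t.subst (Function.update f s u) := by
  induction a generalizing t with
  | nil =>
    rw [eq_leaf_of_nil_mem_posOf ha, subst_leaf, subst_leaf, Function.update_self]
    rfl
  | cons i a ih =>
    cases t with
    | leaf s' => cases ha
    | node σ ts =>
      obtain ⟨hi, ha⟩ := (cons_mem_posOf_node _ _ _ _ _).1 ha
      simp only [subst_node, replaceAt_cons]
      congr 1
      funext j
      split_ifs with hj
      · obtain rfl : j = ⟨i, hi⟩ := Fin.ext hj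
        exact ih (ht.child _) ha
      · refine subst_congr _ fun s' hs' => (Function.update_of_ne ?_ _ _).symm
        rintro rfl
        exact hj (congrArg Fin.val (ht.child_unique (i := j) (j := ⟨i, hi⟩) hs' ⟨a, ha⟩))

/-- Every leaf label at a position `w` is replaced by `F w`. -/
def substPos (F : List ℕ → Tree A U) : Tree A S → Tree A U
  | leaf _ => F []
  | node σ ts => node σ (fun i => substPos (fun w => F (i :: w)) (ts i))

theorem substPos_replaceAt {s : S} {v : List ℕ} {t : Tree A S} (hv : v ∈ t.posOf s)
    (F : List ℕ → Tree A U) (u : Tree A S) :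
    (t.replaceAt v u).substPos F =
      t.substPos (Function.update F v (u.substPos fun w => F (v ++ w))) := by
  induction v generalizing t F with
  | nil =>
    rw [eq_leaf_of_nil_mem_posOf hv, substPos, Function.update_self]
    rfl
  | cons i v ih =>
    cases t with
    | leaf s' => cases hv
    | node σ ts =>
      obtain ⟨hi, hv⟩ := (cons_mem_posOf_node _ _ _ _ _).1 hv
      rw [replaceAt_cons, substPos, substPos]
      congr 1
      funext j
      split_ifs with hj
      · obtain rfl : j = ⟨i, hi⟩ := Fin.ext hj
        rw [ih hv]
        congr 1
        funext w
        simp [Function.update_apply]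
      · congr 1
        funext w
        rw [Function.update_of_ne]
        simp [hj]

/-- Sentential forms may repeat a state, which forces replacement by positions. Sides of rules are
linear, so there one can return to replacement by states. -/
theorem substPos_eq_subst {F : List ℕ → Tree A U} {f : S → Tree A U} {t : Tree A S}
    (h : ∀ s, ∀ w ∈ t.posOf s, F w = f s) : t.substPos F = t.subst f := by
  induction t generalizing F with
  | leaf s => exact h s [] rfl
  | node σ ts ih =>
    rw [substPos, subst_node]
    congr 1
    funext i
    exact ih i fun s w hw => h s _ ((cons_mem_posOf_node _ _ _ _ _).2 ⟨i.2, hw⟩)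

theorem notMem_posOf_incl (s : S) (w : List ℕ) (t : GTree A) : w ∉ (t.incl : Tree A S).posOf s := by
  induction t generalizing w with
  | leaf e => exact e.elim
  | node σ ts ih =>
    cases w with
    | nil => exact nil_notMem_posOf_node _ _ _
    | cons i w => exact fun h => ih _ w ((cons_mem_posOf_node _ _ _ _ _).1 h).2

theorem substPos_incl (F : List ℕ → GTree A) (t : GTree A) : (t.incl : Tree A S).substPos F = t := by
  rw [substPos_eq_subst (f := fun _ => F []) fun s w hw => absurd hw (notMem_posOf_incl s w t),
    incl, subst_subst, subst_ground]

end Tree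

/-! ### Recursive semantics of transducers -/

open TreeTrans.Tree

namespace LXTR

variable {A B : RankedAlphabet} (M : LXTR A B)

/-- The pairs of trees that a state generates, where deleted input subtrees are not checked. -/
inductive Sem : M.State → GTree A → GTree B → Prop
  | rule (ρ : Rule A B M.State) (hρ : ρ ∈ M.rules) (f : M.State → GTree A) (g : M.State → GTree B)
      (h : ∀ p ∈ ρ.rhs.var, Sem p (f p) (g p)) : Sem ρ.state (ρ.lhs.subst f) (ρ.rhs.subst g)

variable {M}

/-- Links join positions, and the links between state occurrences form a partial injection. -/
structure Inv (X : SentForm A B M.State) : Prop where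
  isPos : ∀ v w, (v, w) ∈ X.links → IsPos v X.input ∧ IsPos w X.output
  functional : ∀ v w w' p q q', (v, w) ∈ X.links → (v, w') ∈ X.links → v ∈ X.input.posOf p →
    w ∈ X.output.posOf q → w' ∈ X.output.posOf q' → w = w'
  injective : ∀ v v' w p p' q, (v, w) ∈ X.links → (v', w) ∈ X.links → v ∈ X.input.posOf p →
    v' ∈ X.input.posOf p' → w ∈ X.output.posOf q → v = v'

theorem inv_initial (q : M.State) : Inv (M := M) ⟨.leaf q, {([], [])}, .leaf q⟩ where
  isPos := by
    rintro v w h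
    obtain ⟨rfl, rfl⟩ := Prod.mk.inj h
    exact ⟨rfl, rfl⟩
  functional v w w' _ _ _ h h' _ _ _ := (Prod.mk.inj h).2.trans (Prod.mk.inj h').2.symm
  injective v v' w _ _ _ h h' _ _ _ := (Prod.mk.inj h).1.trans (Prod.mk.inj h').1.symm

/-- Used links are never removed, and after a rule with a single state on one side an old link may
still end at a state occurrence. After a step, a link between two state occurrences either comes
from the rule or is an old link with both ends away from the rewritten positions. -/
theorem Inv.link_cases {X : SentForm A B M.State} (hX : Inv X) {ρ : Rule A B M.State}
    {v w : List ℕ} (hρ : ρ ∈ M.rules) (hlink : (v, w) ∈ X.links)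
    (hv : v ∈ X.input.posOf ρ.state) (hw : w ∈ X.output.posOf ρ.state) {x y : List ℕ}
    (hxy : (x, y) ∈ X.links ∪ ρ.links v w) {p q : M.State}
    (hx : x ∈ (X.input.replaceAt v ρ.lhs).posOf p)
    (hy : y ∈ (X.output.replaceAt w ρ.rhs).posOf q) :
    (∃ p, ∃ a ∈ ρ.lhs.posOf p, ∃ b ∈ ρ.rhs.posOf p, x = v ++ a ∧ y = w ++ b) ∨
      ((x, y) ∈ X.links ∧ x ∈ X.input.posOf p ∧ y ∈ X.output.posOf q ∧ x ≠ v ∧ y ≠ w) := by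
  rcases hxy with hxy | ⟨s, a, ha, b, hb, hab⟩
  · have hpos := hX.isPos _ _ hxy
    rcases (mem_posOf_replaceAt hv).1 hx with ⟨a, rfl, ha⟩ | ⟨hx, hxv⟩ <;>
      rcases (mem_posOf_replaceAt hw).1 hy with ⟨b, rfl, hb⟩ | ⟨hy, hyw⟩
    -- Both sides of the rule are single states, equal by `var_subset`; the old link then coincides
    -- with the link of the rule.
    · obtain rfl := eq_nil_of_isPos_append hv hpos.1
      obtain rfl := eq_nil_of_isPos_append hw hpos.2
      have hqp : q ∈ ρ.lhs.var := M.var_subset ρ hρ ⟨_, hb⟩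
      rw [eq_leaf_of_nil_mem_posOf ha, mem_var_leaf] at hqp
      subst hqp
      exact Or.inl ⟨q, [], ha, [], hb, rfl, rfl⟩
    · obtain rfl := eq_nil_of_isPos_append hv hpos.1
      rw [List.append_nil] at hxy
      exact absurd (hX.functional _ _ _ _ _ _ hxy hlink hv hy hw) hyw
    · obtain rfl := eq_nil_of_isPos_append hw hpos.2
      rw [List.append_nil] at hxy
      exact absurd (hX.injective _ _ _ _ _ _ hxy hlink hx hv hw) hxv
    · exact Or.inr ⟨hxy, hx, hy, hxv, hyw⟩
  · obtain ⟨rfl, rfl⟩ := Prod.mk.inj hab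
    exact Or.inl ⟨s, a, ha, b, hb, rfl, rfl⟩

theorem Inv.step {X Y : SentForm A B M.State} (hX : Inv X) (h : M.Step X Y) : Inv Y := by
  cases h with
  | rule ρ v w hρ hlink hv hw =>
    refine ⟨?_, ?_, ?_⟩
    · rintro x y (h | ⟨p, a, ha, b, hb, hab⟩)
      · exact ⟨(hX.isPos _ _ h).1.replaceAt hv _, (hX.isPos _ _ h).2.replaceAt hw _⟩
      · obtain ⟨rfl, rfl⟩ := Prod.mk.inj hab
        exact ⟨(isPos_of_mem_posOf ha).append_replaceAt hv,
          (isPos_of_mem_posOf hb).append_replaceAt hw⟩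
    · intro x y y' p q q' h h' hx hy hy'
      rcases hX.link_cases hρ hlink hv hw h hx hy with
          ⟨s, a, ha, b, hb, rfl, rfl⟩ | ⟨hl, hx₁, hy₁, hxv, hyw⟩ <;>
        rcases hX.link_cases hρ hlink hv hw h' hx hy' with
          ⟨s', a', ha', b', hb', hxa, rfl⟩ | ⟨hl', hx₂, hy₂, hxv', hyw'⟩
      · obtain rfl := List.append_cancel_left hxa
        obtain rfl := posOf_unique ha ha'
        rw [M.rhs_linear ρ hρ s hb hb']
      · exact absurd (by rw [eq_nil_of_isPos_append hv (isPos_of_mem_posOf hx₂),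
          List.append_nil]) hxv'
      · subst hxa
        exact absurd (by rw [eq_nil_of_isPos_append hv (isPos_of_mem_posOf hx₁),
          List.append_nil]) hxv
      · exact hX.functional _ _ _ _ _ _ hl hl' hx₁ hy₁ hy₂
    · intro x x' y p p' q h h' hx hx' hy
      rcases hX.link_cases hρ hlink hv hw h hx hy with
          ⟨s, a, ha, b, hb, rfl, rfl⟩ | ⟨hl, hx₁, hy₁, hxv, hyw⟩ <;>
        rcases hX.link_cases hρ hlink hv hw h' hx' hy with
          ⟨s', a', ha', b', hb', rfl, hyb⟩ | ⟨hl', hx₂, hy₂, hxv', hyw'⟩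
      · obtain rfl := List.append_cancel_left hyb
        obtain rfl := posOf_unique hb hb'
        rw [M.lhs_linear ρ hρ s ha ha']
      · exact absurd (by rw [eq_nil_of_isPos_append hw (isPos_of_mem_posOf hy₂),
          List.append_nil]) hyw'
      · subst hyb
        exact absurd (by rw [eq_nil_of_isPos_append hw (isPos_of_mem_posOf hy₁),
          List.append_nil]) hyw
      · exact hX.injective _ _ _ _ _ _ hl hl' hx₁ hx₂ hy₁
  | look q v t hv _ _ =>
    have hmem {x : List ℕ} {p : M.State} (h : x ∈ (X.input.replaceAt v t.incl).posOf p) :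
        x ∈ X.input.posOf p := by
      rcases (mem_posOf_replaceAt hv).1 h with ⟨a, _, ha⟩ | h
      exacts [absurd ha (notMem_posOf_incl _ _ _), h.1]
    exact ⟨fun x y h => ⟨(hX.isPos x y h).1.replaceAt hv _, (hX.isPos x y h).2⟩,
      fun x y y' p q q' h h' hx => hX.functional x y y' p q q' h h' (hmem hx),
      fun x x' y p p' q h h' hx hx' => hX.injective x x' y p p' q h h' (hmem hx) (hmem hx')⟩

/-- Every derivation decomposes along the links between state occurrences. -/
theorem exists_substPos_of_derives {X : SentForm A B M.State} {t : GTree A} {D : LinkStruct}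
    {u : GTree B} (h : Relation.ReflTransGen M.Step X ⟨t.incl, D, u.incl⟩) (hX : Inv X) :
    ∃ F G, t = X.input.substPos F ∧ u = X.output.substPos G ∧
      ∀ v w q, (v, w) ∈ X.links → v ∈ X.input.posOf q → w ∈ X.output.posOf q →
        M.Sem q (F v) (G w) := by
  induction h using Relation.ReflTransGen.head_induction_on with
  | refl =>
    exact ⟨fun _ => t, fun _ => u, (substPos_incl _ t).symm, (substPos_incl _ u).symm,
      fun v w q _ hv => absurd hv (notMem_posOf_incl _ _ _)⟩
  | @head X Y hstep _ ih =>
    obtain ⟨F, G, ht, hu, hsem⟩ := ih (hX.step hstep)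
    cases hstep with
    | rule ρ v w hρ hlink hv hw =>
      rw [substPos_replaceAt hv] at ht
      rw [substPos_replaceAt hw] at hu
      refine ⟨_, _, ht, hu, fun x y q hxy hx hy => ?_⟩
      by_cases hxv : x = v
      · subst hxv
        obtain rfl := hX.functional _ _ _ _ _ _ hxy hlink hx hy hw
        obtain rfl := posOf_unique hx hv
        rw [Function.update_self, Function.update_self]
        -- By linearity each state has at most one position in a side of the rule, so a choice by
        -- positions is a choice by states.
        have key {C : RankedAlphabet} {l : Tree C M.State} (hl : l.Linear)
            (H : List ℕ → GTree C) :
            ∃ f : M.State → GTree C, ∀ s, ∀ a ∈ l.posOf s, H a = f s := by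
          classical
          refine ⟨fun s => if h : (l.posOf s).Nonempty then H h.some else H [], fun s a ha => ?_⟩
          have h : (l.posOf s).Nonempty := ⟨a, ha⟩
          simp only [dif_pos h]
          exact congrArg H (hl s ha h.some_mem)
        obtain ⟨f, hf⟩ := key (M.lhs_linear ρ hρ) fun a => F (x ++ a)
        obtain ⟨g, hg⟩ := key (M.rhs_linear ρ hρ) fun a => G (y ++ a)
        rw [substPos_eq_subst hf, substPos_eq_subst hg]
        refine .rule ρ hρ f g fun p hp => ?_
        obtain ⟨a, ha⟩ := M.var_subset ρ hρ hp
        obtain ⟨b, hb⟩ := hp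
        rw [← hf p a ha, ← hg p b hb]
        exact hsem _ _ p (Or.inr ⟨p, a, ha, b, hb, rfl⟩)
          ((mem_posOf_replaceAt hv).2 (Or.inl ⟨a, rfl, ha⟩))
          ((mem_posOf_replaceAt hw).2 (Or.inl ⟨b, rfl, hb⟩))
      · have hyw : y ≠ w := by
          rintro rfl
          exact hxv (hX.injective _ _ _ _ _ _ hxy hlink hx hv hy)
        rw [Function.update_of_ne hxv, Function.update_of_ne hyw]
        exact hsem x y q (Or.inl hxy) ((mem_posOf_replaceAt hv).2 (Or.inr ⟨hx, hxv⟩))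
          ((mem_posOf_replaceAt hw).2 (Or.inr ⟨hy, hyw⟩))
    | look q v s hv hunlinked _ =>
      rw [substPos_replaceAt hv] at ht
      refine ⟨_, G, ht, hu, fun x y p hxy hx hy => ?_⟩
      -- A look-ahead step happens only at an occurrence without a linked partner, so no required
      -- pair involves it.
      have hxv : x ≠ v := by
        rintro rfl
        exact hunlinked y hxy p hy
      rw [Function.update_of_ne hxv]
      exact hsem x y p hxy ((mem_posOf_replaceAt hv).2 (Or.inr ⟨hx, hxv⟩)) hy

theorem exists_sem_of_mem_transformation {t : GTree A} {u : GTree B}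
    (h : (t, u) ∈ M.transformation) : ∃ q ∈ M.initial, M.Sem q t u := by
  obtain ⟨D, q, hq, h⟩ := h
  obtain ⟨F, G, rfl, rfl, hsem⟩ := exists_substPos_of_derives h (inv_initial q)
  exact ⟨q, hq, hsem [] [] q rfl rfl rfl⟩

-- Nondeletion means that every state of the left-hand side is linked, so rules alone finish the
-- derivation and no look-ahead step is needed. The linked states are expanded one at a time;
-- keeping the old links in `D` leaves the remaining ones available.
open Classical in
theorem Sem.derives (hM : M.Nondeleting) {q : M.State} {t : GTree A} {u : GTree B}
    (h : M.Sem q t u) : ∀ (X : SentForm A B M.State) (v w : List ℕ), (v, w) ∈ X.links →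
      v ∈ X.input.posOf q → w ∈ X.output.posOf q → ∃ D, X.links ⊆ D ∧
        Relation.ReflTransGen M.Step X
          ⟨X.input.replaceAt v t.incl, D, X.output.replaceAt w u.incl⟩ := by
  induction h with
  | rule ρ hρ f g _ ih =>
    intro X v w hlink hv hw
    have hvar := hM ρ hρ
    -- `E` is the set of states of the rule that have already been expanded.
    have key (E : Finset M.State) : (∀ p ∈ E, p ∈ ρ.rhs.var) →
        ∃ D, X.links ∪ ρ.links v w ⊆ D ∧ Relation.ReflTransGen M.Step X
          ⟨X.input.replaceAt v (ρ.lhs.subst fun p => if p ∈ E then (f p).incl else leaf p), D,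
            X.output.replaceAt w (ρ.rhs.subst fun p => if p ∈ E then (g p).incl else leaf p)⟩ := by
      induction E using Finset.induction_on with
      | empty =>
        intro _
        refine ⟨_, subset_rfl, Relation.ReflTransGen.single ?_⟩
        simpa [subst_leaf_eq_self] using Step.rule X ρ v w hρ hlink hv hw
      | insert p E hp ihE =>
        intro hE
        obtain ⟨D, hD, hder⟩ := ihE fun p hp => hE p (Finset.mem_insert_of_mem hp)
        have hpr := hE p (Finset.mem_insert_self _ _)
        obtain ⟨a, ha⟩ := M.var_subset ρ hρ hpr
        obtain ⟨b, hb⟩ := id hpr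
        obtain ⟨D', hD', hder'⟩ := ih p hpr
          ⟨X.input.replaceAt v (ρ.lhs.subst fun p => if p ∈ E then (f p).incl else leaf p), D,
            X.output.replaceAt w (ρ.rhs.subst fun p => if p ∈ E then (g p).incl else leaf p)⟩
          (v ++ a) (w ++ b) (hD (Or.inr ⟨p, a, ha, b, hb, rfl⟩))
          ((mem_posOf_replaceAt hv).2 (Or.inl ⟨a, rfl, mem_posOf_subst ha (if_neg hp)⟩))
          ((mem_posOf_replaceAt hw).2 (Or.inl ⟨b, rfl, mem_posOf_subst hb (if_neg hp)⟩))
        refine ⟨D', hD.trans hD', hder.trans ?_⟩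
        have hupd {C : RankedAlphabet} (k : M.State → GTree C) :
            (fun s => if s ∈ insert p E then (k s).incl else leaf s) =
              Function.update (fun s => if s ∈ E then (k s).incl else leaf s) p (k p).incl := by
          funext s
          by_cases hs : s = p
          · subst hs; simp
          · simp [hs]
        rw [hupd f, hupd g, ← (M.lhs_linear ρ hρ).replaceAt_subst ha,
          ← (M.rhs_linear ρ hρ).replaceAt_subst hb, ← replaceAt_append hv, ← replaceAt_append hw]
        exact hder'
    have := M.finite
    obtain ⟨D, hD, hder⟩ := key (Set.toFinite ρ.rhs.var).toFinset (by simp)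
    refine ⟨D, Set.subset_union_left.trans hD, ?_⟩
    have hincl {C : RankedAlphabet} (l : Tree C M.State) (hl : l.var = ρ.rhs.var)
        (k : M.State → GTree C) : (l.subst fun p => if p ∈ (Set.toFinite ρ.rhs.var).toFinset then
          (k p).incl else leaf p) = (l.subst k).incl := by
      rw [incl, subst_subst]
      refine subst_congr _ fun p hp => ?_
      rw [if_pos (by simpa [hl] using hp), incl]
    rwa [hincl _ hvar.symm, hincl _ rfl] at hder

theorem Sem.mem_transformation (hM : M.Nondeleting) {q : M.State} (hq : q ∈ M.initial)
    {t : GTree A} {u : GTree B} (h : M.Sem q t u) : (t, u) ∈ M.transformation := by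
  obtain ⟨D, _, hD⟩ := h.derives hM ⟨.leaf q, {([], [])}, .leaf q⟩ [] [] rfl rfl rfl
  exact ⟨D, q, hq, hD⟩

theorem Sem.linkedPair {K : ℕ} (hK : ∀ ρ ∈ M.rules, ρ.rhs.height ≤ K) {q : M.State}
    {t : GTree A} {u : GTree B} (h : M.Sem q t u) : LinkedPair K t u := by
  induction h with
  | rule ρ hρ f g _ ih =>
    exact .mk _ _ f g (M.rhs_linear ρ hρ) (M.var_subset ρ hρ) (hK ρ hρ) ih

/-- With equal variable sets the two sides of a rule exchange their roles. -/
theorem Sem.linkedPair_swap (hM : M.Nondeleting) {K : ℕ}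
    (hK : ∀ ρ ∈ M.rules, ρ.lhs.height ≤ K) {q : M.State} {t : GTree A} {u : GTree B}
    (h : M.Sem q t u) : LinkedPair K u t := by
  induction h with
  | rule ρ hρ f g _ ih =>
    have hvar := hM ρ hρ
    exact .mk _ _ g f (M.lhs_linear ρ hρ) hvar.ge (hK ρ hρ) fun p hp => ih p (hvar.ge hp)

theorem bushLowering_transformation (M : LXTR A B) : BushLowering 1 M.transformation := by
  obtain ⟨K, hK⟩ := (M.rules_finite.image fun ρ => ρ.rhs.height).bddAbove
  refine bushLowering_one (K := K) fun t u h => ?_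
  obtain ⟨q, _, hq⟩ := exists_sem_of_mem_transformation h
  exact hq.linkedPair fun ρ hρ => hK (Set.mem_image_of_mem _ hρ)

theorem Nondeleting.bushLowering_inv (hM : M.Nondeleting) :
    BushLowering 1 M.transformation.inv := by
  obtain ⟨K, hK⟩ := (M.rules_finite.image fun ρ => ρ.lhs.height).bddAbove
  refine bushLowering_one (K := K) fun t u h => ?_
  obtain ⟨q, _, hq⟩ := exists_sem_of_mem_transformation (SetRel.mem_inv.1 h)
  exact hq.linkedPair_swap hM fun ρ hρ => hK (Set.mem_image_of_mem _ hρ)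

end LXTR

end TreeTrans

namespace TreeTrans

open TreeTrans.Tree

theorem isRegular_univ (A : RankedAlphabet) : IsRegular (Set.univ : Set (GTree A)) :=
  ⟨{ State := Unit, δ := fun _ _ => (), final := Set.univ }, rfl⟩

/-- To pass from depth `j` to `j + 1`, the binary nodes are copied and every leaf is replaced by a
comb of nullary leaves. This needs only three local operations, which the transducer and the
bimorphism below both provide. -/
theorem nestedComb_induction {P : GTree binaryAlphabet → GTree binaryAlphabet → Prop}
    (nullary : P nullary nullary) (insert : ∀ t u, P t u → P t (binary Tree.nullary u))
    (binary : ∀ t u t' u', P t u → P t' u' → P (binary t t') (binary u u')) (m j : ℕ) :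
    P (nestedComb m j) (nestedComb m (j + 1)) := by
  induction j with
  | zero =>
    have (k : ℕ) : P Tree.nullary (comb Tree.nullary k) := by
      induction k with
      | zero => exact nullary
      | succ k ih => exact insert _ _ ih
    exact this m
  | succ j ih =>
    have (k : ℕ) : P (comb (nestedComb m j) k) (comb (nestedComb m (j + 1)) k) := by
      induction k with
      | zero => exact ih
      | succ k ihk => exact binary _ _ _ _ ih ihk
    exact this m

namespace LXTR

/-! ### The identity transducer -/

section Identity

variable (A : RankedAlphabet)

/-- The rule of the identity transducer for the symbol `σ`. -/
def idRule (σ : A.Symbol) (q : Option (Σ σ : A.Symbol, Fin (A.rk σ))) :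
    Rule A A (Option (Σ σ : A.Symbol, Fin (A.rk σ))) where
  lhs := .node σ fun i => .leaf (some ⟨σ, i⟩)
  state := q
  rhs := .node σ fun i => .leaf (some ⟨σ, i⟩)

theorem idRule_linear (σ : A.Symbol) :
    (Tree.node σ fun i => .leaf (some ⟨σ, i⟩) :
      Tree A (Option (Σ σ : A.Symbol, Fin (A.rk σ)))).Linear := by
  refine linear_node (fun i => linear_leaf _) fun i j s hi hj => ?_
  have h := (mem_var_leaf.1 hi).symm.trans (mem_var_leaf.1 hj)
  simpa using h

/-- A separate state for each argument of each symbol makes the rules linear; `none` guarantees a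
state even if all symbols are nullary. -/
def idTransducer : LXTR A A where
  State := Option (Σ σ : A.Symbol, Fin (A.rk σ))
  finite := by
    have := A.finite
    infer_instance
  initial := Set.univ
  rules := Set.range fun x : A.Symbol × Option (Σ σ : A.Symbol, Fin (A.rk σ)) => idRule A x.1 x.2
  rules_finite := by
    have := A.finite
    exact Set.finite_range _
  lhs_linear := by
    rintro _ ⟨x, rfl⟩
    exact idRule_linear A x.1
  rhs_linear := by
    rintro _ ⟨x, rfl⟩
    exact idRule_linear A x.1
  var_subset := by
    rintro _ ⟨x, rfl⟩
    exact subset_rfl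
  lookahead _ := Set.univ
  lookahead_regular _ := isRegular_univ A

theorem idTransducer_nondeleting : (idTransducer A).Nondeleting := by
  rintro _ ⟨x, rfl⟩
  rfl

theorem idTransducer_strict : (idTransducer A).Strict := by
  rintro _ ⟨x, rfl⟩ ⟨s, hs⟩
  cases hs

theorem idTransducer_epsFree : (idTransducer A).EpsFree := by
  rintro _ ⟨x, rfl⟩ ⟨s, hs⟩
  cases hs

theorem idTransducer_sem (t : GTree A) (q : (idTransducer A).State) :
    (idTransducer A).Sem q t t := by
  induction t generalizing q with
  | leaf e => exact e.elim
  | node σ ts ih =>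
    -- The child at `i₀` serves only as a default value at states that do not occur in the rule.
    have key (i₀ : Fin (A.rk σ)) : (idTransducer A).Sem q (.node σ ts) (.node σ ts) := by
      classical
      let f : Option (Σ σ : A.Symbol, Fin (A.rk σ)) → GTree A := fun s =>
        s.elim (ts i₀) fun x => if h : x.1 = σ then ts (h ▸ x.2) else ts i₀
      have hf (i : Fin (A.rk σ)) : f (some ⟨σ, i⟩) = ts i := by simp [f]
      have h := Sem.rule (M := idTransducer A) (idRule A σ q) ⟨(σ, q), rfl⟩ f f fun p hp => by
        obtain ⟨i, hi⟩ := mem_var_node.1 hp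
        rw [mem_var_leaf.1 hi, hf]
        exact ih i _
      have he : (idRule A σ q).lhs.subst f = .node σ ts := by
        simp only [idRule, subst_node, subst_leaf, hf]
      exact he ▸ h
    by_cases h0 : Nonempty (Fin (A.rk σ))
    · exact key h0.some
    · have h := Sem.rule (M := idTransducer A) (idRule A σ q) ⟨(σ, q), rfl⟩
        (fun _ => .node σ ts) (fun _ => .node σ ts) fun p hp => by
          obtain ⟨i, _⟩ := mem_var_node.1 hp
          exact absurd ⟨i⟩ h0
      have he : (idRule A σ q).lhs.subst (fun _ => .node σ ts) = .node σ ts := by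
        simp only [idRule, subst_node]
        congr 1
        funext i
        exact absurd ⟨i⟩ h0
      exact he ▸ h

theorem eq_of_idTransducer_sem {q : (idTransducer A).State} {t u : GTree A}
    (h : (idTransducer A).Sem q t u) : t = u := by
  induction h with
  | rule ρ hρ f g _ ih =>
    obtain ⟨x, rfl⟩ := hρ
    exact subst_congr _ ih

theorem idTransducer_transformation : (idTransducer A).transformation = SetRel.id := by
  ext ⟨t, u⟩
  constructor
  · intro h
    obtain ⟨q, _, hq⟩ := exists_sem_of_mem_transformation h
    exact eq_of_idTransducer_sem A hq
  · rintro (rfl : t = u)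
    exact (idTransducer_sem A t none).mem_transformation (idTransducer_nondeleting A) trivial

end Identity

/-! ### The inverse of a nondeleting transducer -/

section Inverse

variable {A B : RankedAlphabet} {M : LXTR A B}

/-- Look-ahead can be trivial, as nothing is deleted in either direction. -/
def Nondeleting.inverse (hM : M.Nondeleting) : LXTR B A where
  State := M.State
  finite := M.finite
  initial := M.initial
  rules := (fun ρ => ⟨ρ.rhs, ρ.state, ρ.lhs⟩) '' M.rules
  rules_finite := M.rules_finite.image _
  lhs_linear := by
    rintro _ ⟨ρ, hρ, rfl⟩
    exact M.rhs_linear ρ hρ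
  rhs_linear := by
    rintro _ ⟨ρ, hρ, rfl⟩
    exact M.lhs_linear ρ hρ
  var_subset := by
    rintro _ ⟨ρ, hρ, rfl⟩
    exact (hM ρ hρ).ge
  lookahead _ := Set.univ
  lookahead_regular _ := isRegular_univ B

theorem Nondeleting.inverse_nondeleting (hM : M.Nondeleting) : hM.inverse.Nondeleting := by
  rintro _ ⟨ρ, hρ, rfl⟩
  exact (hM ρ hρ).symm

theorem Nondeleting.inverse_epsFree (hM : M.Nondeleting) (h : M.Strict) :
    hM.inverse.EpsFree := by
  rintro _ ⟨ρ, hρ, rfl⟩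
  exact h ρ hρ

theorem Sem.inverse (hM : M.Nondeleting) {q : M.State} {t : GTree A} {u : GTree B}
    (h : M.Sem q t u) : hM.inverse.Sem q u t := by
  induction h with
  | rule ρ hρ f g _ ih =>
    exact .rule (M := hM.inverse) ⟨ρ.rhs, ρ.state, ρ.lhs⟩ ⟨ρ, hρ, rfl⟩ g f
      fun p hp => ih p ((hM ρ hρ).ge hp)

end Inverse

/-! ### A transducer that inserts combs -/

def copyBinaryRule (q : Bool) : Rule binaryAlphabet binaryAlphabet Bool :=
  ⟨binary (.leaf false) (.leaf true), q, binary (.leaf false) (.leaf true)⟩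

def copyNullaryRule (q : Bool) : Rule binaryAlphabet binaryAlphabet Bool := ⟨nullary, q, nullary⟩

/-- This rule consumes no input, which is why `combInserter` is not ε-free; it does produce output,
so the inverse is ε-free. -/
def insertRule (q : Bool) : Rule binaryAlphabet binaryAlphabet Bool :=
  ⟨.leaf q, q, binary nullary (.leaf q)⟩

theorem linear_binary_leaf :
    (binary (.leaf false) (.leaf true) : Tree binaryAlphabet Bool).Linear :=
  linear_binary (linear_leaf _) (linear_leaf _) fun s hs hs' => by
    cases (mem_var_leaf.1 hs).symm.trans (mem_var_leaf.1 hs')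

theorem linear_binary_nullary_leaf {S : Type} (s : S) :
    (binary nullary (.leaf s) : Tree binaryAlphabet S).Linear :=
  linear_binary linear_nullary (linear_leaf _) fun _ hs => (mem_var_nullary.1 hs).elim

theorem var_insertRule (q : Bool) : (insertRule q).rhs.var = (insertRule q).lhs.var := by
  ext s
  simp [insertRule, mem_var_binary, mem_var_nullary]

def combInserter : LXTR binaryAlphabet binaryAlphabet where
  State := Bool
  initial := Set.univ
  rules := Set.range copyBinaryRule ∪ Set.range copyNullaryRule ∪ Set.range insertRule
  rules_finite := ((Set.finite_range _).union (Set.finite_range _)).union (Set.finite_range _)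
  lhs_linear := by
    rintro _ ((⟨q, rfl⟩ | ⟨q, rfl⟩) | ⟨q, rfl⟩)
    exacts [linear_binary_leaf, linear_nullary, linear_leaf _]
  rhs_linear := by
    rintro _ ((⟨q, rfl⟩ | ⟨q, rfl⟩) | ⟨q, rfl⟩)
    exacts [linear_binary_leaf, linear_nullary, linear_binary_nullary_leaf _]
  var_subset := by
    rintro _ ((⟨q, rfl⟩ | ⟨q, rfl⟩) | ⟨q, rfl⟩)
    exacts [subset_rfl, subset_rfl, (var_insertRule q).le]
  lookahead _ := Set.univ
  lookahead_regular _ := isRegular_univ _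

theorem combInserter_nondeleting : combInserter.Nondeleting := by
  rintro _ ((⟨q, rfl⟩ | ⟨q, rfl⟩) | ⟨q, rfl⟩)
  exacts [rfl, rfl, var_insertRule q]

theorem combInserter_strict : combInserter.Strict := by
  rintro _ ((⟨q, rfl⟩ | ⟨q, rfl⟩) | ⟨q, rfl⟩) ⟨s, hs⟩ <;> cases hs

theorem Sem.of_rule {A B : RankedAlphabet} {M : LXTR A B} {ρ : Rule A B M.State}
    (hρ : ρ ∈ M.rules) {f : M.State → GTree A} {g : M.State → GTree B}
    (h : ∀ p ∈ ρ.rhs.var, M.Sem p (f p) (g p)) {t : GTree A} {u : GTree B}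
    (ht : ρ.lhs.subst f = t) (hu : ρ.rhs.subst g = u) : M.Sem ρ.state t u := by
  rw [← ht, ← hu]
  exact .rule ρ hρ f g h

theorem combInserter_sem (m j : ℕ) :
    ∀ q : Bool, combInserter.Sem q (nestedComb m j) (nestedComb m (j + 1)) := by
  refine nestedComb_induction (P := fun t u => ∀ q : Bool, combInserter.Sem q t u) ?_ ?_ ?_ m j
  · intro q
    exact .of_rule (M := combInserter) (ρ := copyNullaryRule q) (Or.inl (Or.inr ⟨q, rfl⟩))
      (f := fun _ => nullary) (g := fun _ => nullary) (fun p hp => (mem_var_nullary.1 hp).elim)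
      (subst_nullary _) (subst_nullary _)
  · intro t u htu q
    exact .of_rule (M := combInserter) (ρ := insertRule q) (Or.inr ⟨q, rfl⟩) (f := fun _ => t) (g := fun _ => u)
      (fun p _ => htu p) rfl
      ((subst_binary _ _ _).trans (congrArg (binary · u) (subst_nullary _)))
  · intro t u t' u' h h' q
    exact .of_rule (M := combInserter) (ρ := copyBinaryRule q) (Or.inl (Or.inl ⟨q, rfl⟩))
      (f := fun b : Bool => bif b then t' else t) (g := fun b : Bool => bif b then u' else u)
      (fun p _ => match p with
        | false => h false
        | true => h' true)
      (subst_binary _ _ _) (subst_binary _ _ _)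

end LXTR

/-! ### Bimorphisms -/

/-- Both homomorphisms unfold the same center tree: the linear input images play the part of
right-hand sides, and completeness supplies the inclusion of variables. -/
theorem bushLowering_inv_of_mem_BLC {A B : RankedAlphabet} {R : SetRel (GTree A) (GTree B)}
    (hR : R ∈ BLC A B) : BushLowering 1 R.inv := by
  obtain ⟨M, hlin, hcompl, rfl⟩ := hR
  have := M.center.finite
  obtain ⟨K, hK⟩ := (Set.finite_range fun γ => (M.input γ).height).bddAbove
  have key (t : GTree M.center) : LinkedPair K (M.output.apply t) (M.input.apply t) := by
    induction t with
    | leaf e => exact e.elim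
    | node γ ts ih =>
      exact .mk (M.output γ) (M.input γ) (fun i => M.output.apply (ts i))
        (fun i => M.input.apply (ts i)) (hlin γ) (fun i _ => hcompl γ i)
        (hK (Set.mem_range_self γ)) fun i _ => ih i
  refine bushLowering_one (K := K) fun u t h => ?_
  obtain ⟨d, _, hd⟩ := SetRel.mem_inv.1 h
  obtain ⟨rfl, rfl⟩ := Prod.mk.inj hd
  exact key d

def idTreeHom (A : RankedAlphabet) : TreeHom A A := fun γ => .node γ .leaf

theorem idTreeHom_apply {A : RankedAlphabet} (t : GTree A) : (idTreeHom A).apply t = t := by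
  induction t with
  | leaf e => rfl
  | node γ ts ih => simp only [TreeHom.apply, idTreeHom, subst_node, subst_leaf] at ih ⊢; simp [ih]

theorem id_mem_BLC (A : RankedAlphabet) : SetRel.id ∈ BLC A A := by
  refine ⟨⟨A, idTreeHom A, Set.univ, isRegular_univ A, idTreeHom A⟩, fun γ => ?_, fun γ i => ?_, ?_⟩
  · exact linear_node (fun i => linear_leaf _)
      fun i j s hi hj => (mem_var_leaf.1 hi).symm.trans (mem_var_leaf.1 hj)
  · exact mem_var_node.2 ⟨i, mem_var_leaf.2 rfl⟩
  · ext ⟨t, u⟩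
    constructor
    · rintro ⟨d, _, hd⟩
      obtain ⟨rfl, rfl⟩ := Prod.mk.inj hd
      rfl
    · rintro (rfl : t = u)
      exact ⟨t, trivial, by simp only [idTreeHom_apply]⟩

/-- The binary alphabet extended by a unary symbol `none`. -/
def unaryExtension : RankedAlphabet where
  Symbol := Option Bool
  rk
    | none => 1
    | some b => bif b then 2 else 0

/-- The unary symbol marks an inserted comb tooth, present in the input and erased by the output
homomorphism. -/
def combBimorphismInput : TreeHom unaryExtension binaryAlphabet
  | none => binary nullary (.leaf (0 : Fin 1))
  | some true => binary (.leaf (0 : Fin 2)) (.leaf (1 : Fin 2))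
  | some false => nullary

def combBimorphismOutput : TreeHom unaryExtension binaryAlphabet
  | none => .leaf (0 : Fin 1)
  | some true => binary (.leaf (0 : Fin 2)) (.leaf (1 : Fin 2))
  | some false => nullary

def combBimorphism : Bimorphism binaryAlphabet binaryAlphabet :=
  ⟨unaryExtension, combBimorphismInput, Set.univ, isRegular_univ _, combBimorphismOutput⟩

theorem combBimorphism_linear : combBimorphism.input.Linear := by
  rintro (_ | _ | _)
  · exact LXTR.linear_binary_nullary_leaf (S := Fin 1) 0
  · exact linear_nullary
  · exact linear_binary (S := Fin 2) (linear_leaf _) (linear_leaf _) fun s hs hs' => by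
      cases (mem_var_leaf.1 hs).symm.trans (mem_var_leaf.1 hs')

theorem combBimorphism_complete : combBimorphism.output.Complete := by
  rintro (_ | _ | _) i
  · exact mem_var_leaf.2 (Subsingleton.elim (α := Fin 1) i 0)
  · exact Fin.elim0 i
  · refine mem_var_binary.2 ?_
    exact ((by decide : ∀ i : Fin 2, i = 0 ∨ i = 1) i).imp mem_var_leaf.2 mem_var_leaf.2

theorem nestedComb_mem_combBimorphism (m j : ℕ) :
    (nestedComb m (j + 1), nestedComb m j) ∈ combBimorphism.transformation := by
  refine nestedComb_induction (P := fun t u => (u, t) ∈ combBimorphism.transformation) ?_ ?_ ?_ m j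
  · exact ⟨.node (A := unaryExtension) (some false) Fin.elim0, trivial,
      Prod.ext (subst_nullary _).symm (subst_nullary _).symm⟩
  · rintro t u ⟨d, _, hd⟩
    obtain ⟨rfl, rfl⟩ := Prod.mk.inj hd
    refine ⟨.node (A := unaryExtension) none fun _ => d, trivial, Prod.ext ?_ rfl⟩
    exact ((subst_binary (S := Fin 1) _ _ _).trans
      (congrArg (binary · (combBimorphism.input.apply d)) (subst_nullary _))).symm
  · rintro t u t' u' ⟨d, _, hd⟩ ⟨d', _, hd'⟩
    obtain ⟨rfl, rfl⟩ := Prod.mk.inj hd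
    obtain ⟨rfl, rfl⟩ := Prod.mk.inj hd'
    refine ⟨.node (A := unaryExtension) (some true) fun i => if i.val = 0 then d else d', trivial,
      Prod.ext ?_ ?_⟩ <;>
    · refine Eq.trans ?_ (subst_binary (S := Fin 2) _ _ _).symm
      rfl

/-! ### The hierarchies -/

theorem lXT_subset_lXTR (e s d : Bool) (A B : RankedAlphabet) : lXT e s d A B ⊆ lXTR e s d A B :=
  fun _ ⟨M, _, h⟩ => ⟨M, h⟩

theorem id_mem_lXT (e s d : Bool) (A : RankedAlphabet) : SetRel.id ∈ lXT e s d A A :=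
  ⟨LXTR.idTransducer A, fun _ => rfl, fun _ => LXTR.idTransducer_epsFree A,
    fun _ => LXTR.idTransducer_strict A, fun _ => LXTR.idTransducer_nondeleting A,
    LXTR.idTransducer_transformation A⟩

theorem combInserter_mem_lXT (s d : Bool) :
    LXTR.combInserter.transformation ∈ lXT false s d binaryAlphabet binaryAlphabet :=
  ⟨LXTR.combInserter, fun _ => rfl, fun h => (Bool.false_ne_true h).elim,
    fun _ => LXTR.combInserter_strict, fun _ => LXTR.combInserter_nondeleting, rfl⟩

theorem nestedComb_mem_combInserter (m j : ℕ) :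
    (nestedComb m j, nestedComb m (j + 1)) ∈ LXTR.combInserter.transformation :=
  (LXTR.combInserter_sem m j true).mem_transformation LXTR.combInserter_nondeleting trivial

theorem bushLowering_of_mem_lXTR {e s d : Bool} {A B : RankedAlphabet}
    {R : SetRel (GTree A) (GTree B)} (hR : R ∈ lXTR e s d A B) : BushLowering 1 R := by
  obtain ⟨M, _, _, _, rfl⟩ := hR
  exact M.bushLowering_transformation

theorem BLC_power_lt {n : ℕ} (hn : 1 ≤ n) : BLC.power n < BLC.power (n + 1) :=
  TransClass.power_lt_of_bushLowering_inv id_mem_BLC (fun _ => bushLowering_inv_of_mem_BLC)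
    ⟨combBimorphism, combBimorphism_linear, combBimorphism_complete, rfl⟩
    nestedComb_mem_combBimorphism hn

/-- Insertion is not available without ε-rules, so the witness is the inverse of `combInserter`,
which removes one level of combs. -/
theorem lXT_epsFree_nondel_power_lt {n : ℕ} (hn : 1 ≤ n) :
    (lXT true false true).power n < (lXT true false true).power (n + 1) := by
  have hM := LXTR.combInserter_nondeleting
  refine TransClass.power_lt_of_bushLowering_inv (id_mem_lXT _ _ _) ?_
    (τ := hM.inverse.transformation) ⟨hM.inverse, fun _ => rfl,
      fun _ => hM.inverse_epsFree LXTR.combInserter_strict, fun h => (Bool.false_ne_true h).elim,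
      fun _ => hM.inverse_nondeleting, rfl⟩
    (fun m j => ((LXTR.combInserter_sem m j true).inverse hM).mem_transformation
      hM.inverse_nondeleting trivial) hn
  rintro A B _ ⟨M, _, _, _, hnd, rfl⟩
  exact (hnd rfl).bushLowering_inv

theorem lXT_power_lt (s d : Bool) {n : ℕ} (hn : 1 ≤ n) :
    (lXT false s d).power n < (lXT false s d).power (n + 1) :=
  TransClass.power_lt_of_bushLowering (id_mem_lXT _ _ _)
    (fun _ hR => bushLowering_of_mem_lXTR (lXT_subset_lXTR _ _ _ _ _ hR))
    (combInserter_mem_lXT s d) nestedComb_mem_combInserter hn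

theorem lXTR_power_lt (s d : Bool) {n : ℕ} (hn : 1 ≤ n) :
    (lXTR false s d).power n < (lXTR false s d).power (n + 1) :=
  TransClass.power_lt_of_bushLowering
    (fun A => lXT_subset_lXTR _ _ _ _ _ (id_mem_lXT _ _ _ A))
    (fun _ hR => bushLowering_of_mem_lXTR hR)
    (lXT_subset_lXTR _ _ _ _ _ (combInserter_mem_lXT s d)) nestedComb_mem_combInserter hn

end TreeTrans

theorem mainTheorem4 (n : ℕ) (hn : 1 ≤ n) :
    TreeTrans.BLC.power n < TreeTrans.BLC.power (n + 1) ∧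
    (TreeTrans.lXT (epsFree := true) (strict := false) (nondel := true)).power n <
      (TreeTrans.lXT (epsFree := true) (strict := false) (nondel := true)).power (n + 1) ∧
    (∀ s d : Bool,
      (TreeTrans.lXT (epsFree := false) (strict := s) (nondel := d)).power n <
        (TreeTrans.lXT (epsFree := false) (strict := s) (nondel := d)).power (n + 1)) ∧
    (∀ s d : Bool,
      (TreeTrans.lXTR (epsFree := false) (strict := s) (nondel := d)).power n <
        (TreeTrans.lXTR (epsFree := false) (strict := s) (nondel := d)).power (n + 1)) :=
  ⟨TreeTrans.BLC_power_lt hn, TreeTrans.lXT_epsFree_nondel_power_lt hn,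
    fun s d => TreeTrans.lXT_power_lt s d hn, fun s d => TreeTrans.lXTR_power_lt s d hn⟩
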